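/- Let $\omega=-\tfrac12+\tfrac{\sqrt3}{2}i$, let $\mathbb{Z}[\omega]=\{a+b\omega : a,b\in\mathbb{Z}\}$, and let $N(a+b\omega)=a^2-ab+b^2$. For a prime $\pi$ of $\mathbb{Z}[\omega]$ with $N\pi\neq 3$ and $\alpha\in\mathbb{Z}[\omega]$, the cubic residue character $\chi_\pi(\alpha)$ is $0$ if $\pi\mid\alpha$, and otherwise is the unique element of $\{1,\omega,\omega^2\}$ with $\alpha^{(N\pi-1)/3}\equiv\chi_\pi(\alpha)\pmod{\pi}$. A prime $\pi$ of $\mathbb{Z}[\omega]$ is called primary if $\pi\equiv 2\pmod 3$ in $\mathbb{Z}[\omega]$. **Theorem (The Law of Cubic Reciprocity).** Let $\pi_1,\pi_2$ be primary primes of $\mathbb{Z}[\omega]$ with $N\pi_1\neq 3$, $N\pi_2\neq 3$ and $N\pi_1\neq N\pi_2$. Then $$\chi_{\pi_1}(\pi_2)=\chi_{\pi_2}(\pi_1).$$ Moreover, $\pi_1$ is a cubic residue modulo $\pi_2$ (that is, $x^3\equiv\pi_1\pmod{\pi_2}$ is solvable in $\mathbb{Z}[\omega]$) if and only if $\pi_2$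 is a cubic residue modulo $\pi_1$. -/

import Mathlib

/-- The ring `ℤ[ω]` of Eisenstein integers `a + b ω` with `a b : ℤ` and `ω ^ 2 = -1 - ω`;
the coordinates of `α` are `α.re = a` and `α.im = b`. -/
abbrev EisensteinInt : Type := QuadraticAlgebra ℤ (-1) (-1)

namespace EisensteinInt

/-- The cube root of unity `ω`. -/
def omega : EisensteinInt := ⟨0, 1⟩

theorem one_add_omega_add_omega_sq : 1 + omega + omega ^ 2 = 0 := by
  ext <;> simp [omega, pow_two, QuadraticAlgebra.re_one, QuadraticAlgebra.im_one]

/-- The embedding of `ℤ[ω]` in `ℂ` that sends `ω` to `-1/2 + i √3/2`. -/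
noncomputable def toComplex : EisensteinInt →ₐ[ℤ] ℂ :=
  QuadraticAlgebra.lift ⟨⟨-1 / 2, √3 / 2⟩, by
    have h : √3 * √3 = 3 := Real.mul_self_sqrt (by norm_num)
    apply Complex.ext <;> simp <;> linarith⟩

theorem toComplex_apply (α : EisensteinInt) :
    toComplex α = α.re + α.im * (⟨-1 / 2, √3 / 2⟩ : ℂ) := by
  simp [toComplex, QuadraticAlgebra.lift]

theorem toComplex_injective : Function.Injective toComplex := by
  intro α β h
  rw [toComplex_apply, toComplex_apply] at h
  have h1 := congrArg Complex.re h
  have h2 := congrArg Complex.im h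
  simp at h1 h2
  ext
  · rw [h2] at h1; simpa using h1
  · exact h2

/-- The norm `N(a + b ω) = a ^ 2 - a b + b ^ 2`. -/
def norm (α : EisensteinInt) : ℤ := α.re ^ 2 - α.re * α.im + α.im ^ 2

/-- The norm is the product of an element and its complex conjugate. -/
theorem norm_eq_mul_conj (α : EisensteinInt) :
    ((norm α : ℤ) : ℂ) = toComplex α * (starRingEnd ℂ) (toComplex α) := by
  have h : √3 * √3 = 3 := Real.mul_self_sqrt (by norm_num)
  rw [toComplex_apply]
  apply Complex.ext
  · simp [norm, pow_two]; linear_combination (-(α.im : ℝ) ^ 2 / 4) * h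
  · simp [norm, pow_two]; ring

/-- A primary prime: a prime element of `ℤ[ω]` congruent to `2` modulo `3`. -/
def IsPrimary (π : EisensteinInt) : Prop := Prime π ∧ (3 : EisensteinInt) ∣ π - 2

/-- `α` is a cubic residue modulo `π`: the congruence `x ^ 3 ≡ α (mod π)` is solvable. -/
def IsCubicResidue (π α : EisensteinInt) : Prop := ∃ x : EisensteinInt, π ∣ x ^ 3 - α

open Classical in
/-- The cubic residue character `χ_π(α)`, for a prime `π` with `N π ≠ 3`: it is `0` if `π ∣ α`, and
otherwise the element of `{1, ω, ω ^ 2}` congruent to `α ^ ((N π - 1) / 3)` modulo `π`. For such `π`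
the number `N π - 1` is a positive multiple of `3`, exactly one of the three congruences holds, and
the last default value is not taken. -/
noncomputable def cubicChar (π α : EisensteinInt) : EisensteinInt :=
  if π ∣ α then 0
  else if π ∣ α ^ ((norm π - 1) / 3).toNat - 1 then 1
  else if π ∣ α ^ ((norm π - 1) / 3).toNat - omega then omega
  else if π ∣ α ^ ((norm π - 1) / 3).toNat - omega ^ 2 then omega ^ 2
  else 0

end EisensteinInt

/-! Let `χ` be the cubic character of the residue field `F₁` of `π₁`, with values in `ℤ[ω]`. Its
Jacobi sum is exactly `π₁` (`jacobiSum_eq`): it is divisible by `π₁`, has the norm of `π₁`, and is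
`-1` modulo `3`, which fixes the unit. So a cubic Gauss sum `g` of `χ`, taken in an extension of the
residue field `F₂`, satisfies `g ^ 3 = N π₁ * π₁`. Let `q = N π₂`. Frobenius gives `g ^ q = χ(q)⁻¹ *
g`, while the cube formula gives `g ^ q = χ_{π₂}(N π₁ * π₁) * g`. Hence `χ_{π₁}(N π₂) * χ_{π₂}(N π₁)
* χ_{π₂}(π₁) = 1`. The first two factors together are symmetric in `π₁` and `π₂`, so the third is
too. Rational and non-rational primes are treated alike. -/

namespace EisensteinInt

/-! ### Norm, units and residue fields -/

theorem norm_eq_quadraticAlgebra_norm (α : EisensteinInt) : norm α = QuadraticAlgebra.norm α := by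
  rw [QuadraticAlgebra.norm_def, norm]; ring

theorem norm_mul (α β : EisensteinInt) : norm (α * β) = norm α * norm β := by
  simp [norm_eq_quadraticAlgebra_norm]

theorem norm_nonneg (α : EisensteinInt) : 0 ≤ norm α := by
  unfold norm; nlinarith [sq_nonneg (2 * α.re - α.im), sq_nonneg α.im]

theorem norm_natCast (n : ℕ) : norm (n : EisensteinInt) = n ^ 2 := by
  rw [norm_eq_quadraticAlgebra_norm, QuadraticAlgebra.norm_natCast]

theorem isUnit_iff_norm_eq_one (α : EisensteinInt) : IsUnit α ↔ norm α = 1 := by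
  rw [QuadraticAlgebra.isUnit_iff_norm_isUnit, ← norm_eq_quadraticAlgebra_norm, Int.isUnit_iff]
  have := norm_nonneg α
  omega

instance : IsDomain EisensteinInt :=
  toComplex_injective.isDomain toComplex.toRingHom

theorem norm_eq_zero_iff (α : EisensteinInt) : norm α = 0 ↔ α = 0 := by
  constructor
  · intro h
    have h' := norm_eq_mul_conj α
    rw [h, Int.cast_zero, eq_comm, Complex.mul_conj, Complex.ofReal_eq_zero,
      Complex.normSq_eq_zero] at h'
    exact toComplex_injective (by rw [h', map_zero])
  · rintro rfl; simp [norm]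

theorem omega_cube : omega ^ 3 = 1 := by
  linear_combination (omega - 1) * one_add_omega_add_omega_sq

theorem three_dvd_iff (α : EisensteinInt) :
    (3 : EisensteinInt) ∣ α ↔ (3 : ℤ) ∣ α.re ∧ (3 : ℤ) ∣ α.im := by
  have := QuadraticAlgebra.algebraMap_dvd_iff (r := (3 : ℤ)) (z := α)
  simpa using this

theorem eq_one_of_norm_eq_one {u : EisensteinInt} (hu : norm u = 1)
    (h : (3 : EisensteinInt) ∣ u - 1) : u = 1 := by
  obtain ⟨⟨a, ha⟩, b, hb⟩ := (three_dvd_iff _).1 h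
  simp [QuadraticAlgebra.re_one, QuadraticAlgebra.im_one] at ha hb
  have ha' : u.re = 1 + 3 * a := by omega
  rw [norm, ha', hb] at hu
  have hb0 : b = 0 := by
    by_contra hb0
    have : 0 < b ^ 2 := by positivity
    nlinarith [sq_nonneg (2 * (1 + 3 * a) - 3 * b)]
  subst hb0
  have ha0 : a = 0 := by
    have : a * (3 * a + 2) = 0 := by linarith
    rcases mul_eq_zero.1 this with h | h <;> omega
  ext <;> simp [ha', hb, ha0, QuadraticAlgebra.re_one, QuadraticAlgebra.im_one]

theorem norm_modEq_one {π : EisensteinInt} (h : (3 : EisensteinInt) ∣ π - 2) :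
    (3 : ℤ) ∣ norm π - 1 := by
  obtain ⟨⟨a, ha⟩, b, hb⟩ := (three_dvd_iff _).1 h
  simp [QuadraticAlgebra.re_ofNat, QuadraticAlgebra.im_ofNat] at ha hb
  have ha' : π.re = 2 + 3 * a := by omega
  rw [norm, ha', hb]
  exact ⟨1 + 4 * a + 3 * a ^ 2 - 2 * b - 3 * a * b + 3 * b ^ 2, by ring⟩

/-- The residue field of a prime of `ℤ[ω]`. -/
theorem exists_residueField {π : EisensteinInt} (hπ : Prime π) :
    ∃ (F : Type) (_ : Field F) (_ : Fintype F) (f : EisensteinInt →+* F),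
      Function.Surjective f ∧ (∀ α, f α = 0 ↔ π ∣ α) ∧ (Fintype.card F : ℤ) = norm π := by
  -- The index of the ideal `(π)` is the determinant of multiplication by `π`, which is the norm.
  have hdet : Nat.card (EisensteinInt ⧸ Ideal.span {π}) = (norm π).natAbs := by
    rw [norm_eq_quadraticAlgebra_norm, ← QuadraticAlgebra.det_toLinearMap_eq_norm]
    have := Submodule.natAbs_det_equiv ((Ideal.span {π}).restrictScalars ℤ)
      ((LinearEquiv.toSpanNonzeroSingleton EisensteinInt EisensteinInt π hπ.ne_zero).restrictScalars ℤ)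
    refine this.symm.trans ?_
    congr 2
    refine LinearMap.ext fun x => ?_
    change _ = π * x
    rw [mul_comm]
    rfl
  have hpos : norm π ≠ 0 := by rw [Ne, norm_eq_zero_iff]; exact hπ.ne_zero
  have : Finite (EisensteinInt ⧸ Ideal.span {π}) :=
    Nat.finite_of_card_ne_zero (by rw [hdet]; simpa using hpos)
  have hp : (Ideal.span {π}).IsPrime := (Ideal.span_singleton_prime hπ.ne_zero).2 hπ
  let _ : Fintype (EisensteinInt ⧸ Ideal.span {π}) := Fintype.ofFinite _
  refine ⟨EisensteinInt ⧸ Ideal.span {π}, (Finite.isField_of_domain _).toField, inferInstance,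
    Ideal.Quotient.mk _, Ideal.Quotient.mk_surjective, fun α => ?_, ?_⟩
  · exact Ideal.Quotient.eq_zero_iff_dvd π α
  · rw [← Nat.card_eq_fintype_card, hdet, Int.natCast_natAbs, abs_of_nonneg (norm_nonneg π)]

/-! ### The cubic character on the residue field -/

section ResidueField

variable {π : EisensteinInt} {F : Type} [Field F] {f : EisensteinInt →+* F}

/-- Otherwise `π` divides `3`, hence `2` because `π ≡ 2` modulo `3`, hence `1`. -/
theorem map_omega_ne_one (hπ : IsPrimary π) (hker : ∀ α, f α = 0 ↔ π ∣ α) : f omega ≠ 1 := by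
  intro h
  have h0 := congrArg f one_add_omega_add_omega_sq
  simp only [map_add, map_one, map_pow, map_zero, h] at h0
  have h3 : π ∣ 3 := (hker 3).1 (by rw [map_ofNat]; linear_combination h0)
  have h2 : π ∣ 2 := by simpa using dvd_sub dvd_rfl (h3.trans hπ.2)
  exact hπ.1.not_dvd_one (by simpa [show (3 : EisensteinInt) - 2 = 1 by norm_num] using dvd_sub h3 h2)

/-- Identities between values of the character can therefore be checked in the residue field. -/
theorem map_injOn (hπ : IsPrimary π) (hker : ∀ α, f α = 0 ↔ π ∣ α) :
    Set.InjOn f {0, 1, omega, omega ^ 2} := by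
  have h1 := map_omega_ne_one hπ hker
  have h3 : f omega ^ 3 = 1 := by rw [← map_pow, omega_cube, map_one]
  have h0 : f omega ≠ 0 := by intro h; simp [h] at h3
  have h5 : f omega ^ 2 ≠ 0 := pow_ne_zero 2 h0
  have h2 : f omega ^ 2 ≠ 1 := fun h => h1 (by rw [pow_succ, h, one_mul] at h3; exact h3)
  have h4 : f omega ≠ f omega ^ 2 := fun h => h1 (by
    rw [pow_two] at h; exact (mul_left_cancel₀ h0 (by rw [mul_one]; exact h)).symm)
  rintro x (rfl | rfl | rfl | rfl) y (rfl | rfl | rfl | rfl) hxy <;>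
    simp only [map_zero, map_one, map_pow] at hxy <;>
    first | rfl | (exfalso; first | exact zero_ne_one hxy | exact one_ne_zero hxy | tauto)

theorem mul_mem_roots {x y : EisensteinInt} (hx : x ∈ ({0, 1, omega, omega ^ 2} : Set EisensteinInt))
    (hy : y ∈ ({0, 1, omega, omega ^ 2} : Set EisensteinInt)) :
    x * y ∈ ({0, 1, omega, omega ^ 2} : Set EisensteinInt) := by
  have h3 := omega_cube
  have h4 : omega * omega ^ 2 = 1 := by rw [← h3]; ring
  have h5 : omega ^ 2 * omega = 1 := by rw [← h3]; ring
  have h6 : omega ^ 2 * omega ^ 2 = omega := by linear_combination omega * h3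
  rcases hx with rfl | rfl | rfl | rfl <;> rcases hy with rfl | rfl | rfl | rfl <;>
    simp [h4, h5, h6, ← pow_two]

variable [Fintype F]

theorem three_dvd_card_sub_one (hπ : IsPrimary π) (hcard : (Fintype.card F : ℤ) = norm π) :
    3 ∣ Fintype.card F - 1 := by
  have := norm_modEq_one hπ.2
  have := Fintype.card_pos (α := F)
  omega

theorem cubicChar_spec (hπ : IsPrimary π) (hker : ∀ α, f α = 0 ↔ π ∣ α)
    (hcard : (Fintype.card F : ℤ) = norm π) (α : EisensteinInt) :
    cubicChar π α ∈ ({0, 1, omega, omega ^ 2} : Set EisensteinInt) ∧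
      f (cubicChar π α) = f α ^ ((Fintype.card F - 1) / 3) := by
  obtain ⟨k, hk⟩ := three_dvd_card_sub_one (F := F) hπ hcard
  have hpos := Fintype.one_lt_card (α := F)
  have hk' : ((norm π - 1) / 3).toNat = k := by omega
  have hk0 : k ≠ 0 := by omega
  have hdvd : ∀ β γ, π ∣ β - γ ↔ f β = f γ := fun β γ => by
    rw [← hker, map_sub, sub_eq_zero]
  rw [hk, Nat.mul_div_cancel_left k (by norm_num)]
  unfold cubicChar
  rw [hk']
  split_ifs with h0 h1 h2 h3 <;> simp only [hdvd, ← hker, map_pow, map_one] at *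
  · simp [h0, hk0]
  · simp [← h1]
  · simp [← h2]
  · simp [h3]
  · exfalso
    have hF : (f α ^ k) ^ 3 = 1 := by
      rw [← pow_mul, mul_comm, ← hk]; exact FiniteField.pow_card_sub_one_eq_one _ h0
    have hω := congrArg f one_add_omega_add_omega_sq
    have hω3 := congrArg f omega_cube
    simp only [map_add, map_one, map_pow, map_zero] at hω hω3
    -- The factorization of `y ^ 3 - 1` at `y = f α ^ k`.
    have : (f α ^ k - 1) * ((f α ^ k - f omega) * (f α ^ k - f omega ^ 2)) = 0 := by
      linear_combination hF + (f α ^ k - (f α ^ k) ^ 2) * hω + (f α ^ k - 1) * hω3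
    simp only [mul_eq_zero, sub_eq_zero] at this
    tauto

/-- The cubic residue character as a multiplicative character of the residue field. -/
theorem exists_mulChar (hπ : IsPrimary π) (hf : Function.Surjective f)
    (hker : ∀ α, f α = 0 ↔ π ∣ α) (hcard : (Fintype.card F : ℤ) = norm π) :
    ∃ χ : MulChar F EisensteinInt, (∀ α, χ (f α) = cubicChar π α) ∧
      ∀ x, f (χ x) = x ^ ((Fintype.card F - 1) / 3) := by
  have hspec := cubicChar_spec hπ hker hcard
  have hinj := map_injOn hπ hker
  obtain ⟨k, hk⟩ := three_dvd_card_sub_one (F := F) hπ hcard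
  have hpos := Fintype.one_lt_card (α := F)
  have hk0 : (Fintype.card F - 1) / 3 ≠ 0 := by omega
  obtain ⟨s, hs⟩ := hf.hasRightInverse
  refine ⟨MulChar.mk ⟨⟨fun x => cubicChar π (s x), ?_⟩, ?_⟩ ?_, fun α => ?_, fun x => ?_⟩
  · apply hinj (hspec _).1 (by simp)
    rw [(hspec _).2, hs, map_one, one_pow]
  · intro x y
    apply hinj (hspec _).1 (mul_mem_roots (hspec _).1 (hspec _).1)
    rw [map_mul, (hspec _).2, (hspec _).2, (hspec _).2, hs, hs, hs, mul_pow]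
  · intro x hx
    have hx : x = 0 := by simpa using hx
    apply hinj (hspec _).1 (by simp)
    rw [(hspec _).2, hs, hx, zero_pow hk0, map_zero]
  · apply hinj (hspec _).1 (hspec _).1
    rw [(hspec _).2, (hspec _).2, hs]
  · change f (cubicChar π (s x)) = _
    rw [(hspec _).2, hs]

end ResidueField

/-! ### Jacobi sums and cubes in the residue field -/

section ResidueField

variable {π : EisensteinInt} {F : Type} [Field F] [Fintype F] {f : EisensteinInt →+* F}
  {χ : MulChar F EisensteinInt}

theorem mulChar_ne_one (hdvd : 3 ∣ Fintype.card F - 1)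
    (hχ : ∀ x, f (χ x) = x ^ ((Fintype.card F - 1) / 3)) : χ ≠ 1 := by
  rintro rfl
  obtain ⟨g, hg⟩ := IsCyclic.exists_ofOrder_eq_natCard (α := Fˣ)
  have hone := Fintype.one_lt_card (α := F)
  rw [Nat.card_units, Nat.card_eq_fintype_card] at hg
  have h := hχ g
  rw [MulChar.one_apply_coe, map_one, eq_comm, ← Units.val_pow_eq_pow_val, Units.val_eq_one,
    ← orderOf_dvd_iff_pow_eq_one, hg] at h
  have := Nat.le_of_dvd (by omega) h
  omega

theorem mulChar_pow_three (hπ : IsPrimary π) (hker : ∀ α, f α = 0 ↔ π ∣ α)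
    (hf : Function.Surjective f) (hcard : (Fintype.card F : ℤ) = norm π)
    (hχ' : ∀ α, χ (f α) = cubicChar π α) : χ ^ 3 = 1 := by
  refine MulChar.ext fun x => ?_
  obtain ⟨α, hα⟩ := hf x
  have h0 : χ (x : F) ≠ 0 := (x.isUnit.map χ).ne_zero
  rw [MulChar.pow_apply_coe, MulChar.one_apply_coe]
  rw [← hα, hχ'] at h0 ⊢
  rcases (cubicChar_spec hπ hker hcard α).1 with h | h | h | h <;> rw [h] at h0 ⊢
  · exact absurd rfl h0
  · exact one_pow 3
  · exact omega_cube
  · rw [← pow_mul, mul_comm, pow_mul, omega_cube, one_pow]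

/-- Modulo `π` the sum becomes `∑ x ^ k * (1 - x) ^ k`, of degree `2 * k < |F| - 1`, and power sums
of such exponents vanish. -/
theorem dvd_jacobiSum (hker : ∀ α, f α = 0 ↔ π ∣ α)
    (hχ : ∀ x, f (χ x) = x ^ ((Fintype.card F - 1) / 3)) : π ∣ jacobiSum χ χ := by
  set k := (Fintype.card F - 1) / 3
  have hone := Fintype.one_lt_card (α := F)
  rw [← hker, jacobiSum, map_sum]
  calc ∑ x, f (χ x * χ (1 - x))
      = ∑ x : F, ∑ i ∈ Finset.range (k + 1), (-1) ^ (k - i) * (k.choose i : F) * x ^ (k + (k - i)) := by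
        refine Finset.sum_congr rfl fun x _ => ?_
        rw [map_mul, hχ, hχ, sub_eq_add_neg, add_pow, Finset.mul_sum]
        refine Finset.sum_congr rfl fun i _ => ?_
        rw [one_pow, neg_pow, pow_add]; ring
    _ = 0 := by
        rw [Finset.sum_comm]
        refine Finset.sum_eq_zero fun i _ => ?_
        rw [← Finset.mul_sum, FiniteField.sum_pow_lt_card_sub_one _ _ (by omega), mul_zero]

/-- Over `ℂ` the inverse character is the conjugate one, so this is the classical `|J| ^ 2 = |F|`.
-/
theorem norm_jacobiSum (h3 : χ ^ 3 = 1) (h1 : χ ≠ 1) :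
    norm (jacobiSum χ χ) = Fintype.card F := by
  set φ : MulChar F ℂ := χ.ringHomComp toComplex.toRingHom with hφ
  have hinj : Function.Injective toComplex.toRingHom := toComplex_injective
  have hφ1 : φ ≠ 1 := (MulChar.ringHomComp_ne_one_iff hinj).2 h1
  have hφ3 : φ ^ 3 = 1 := by rw [hφ, MulChar.ringHomComp_pow, h3, MulChar.ringHomComp_one]
  have hφ2 : φ * φ ≠ 1 := fun h => hφ1 (by rw [pow_succ, pow_two, h, one_mul] at hφ3; exact hφ3)
  have hchar : ringChar ℂ ≠ ringChar F := by
    rw [ringChar.eq_zero]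
    exact (CharP.char_ne_zero_of_finite F (ringChar F)).symm
  have hmul := jacobiSum_mul_jacobiSum_inv hchar hφ1 hφ1 hφ2
  have hstar : jacobiSum φ⁻¹ φ⁻¹ = (starRingEnd ℂ) (jacobiSum φ φ) := by
    simp only [jacobiSum, map_sum, map_mul]
    simp only [← MulChar.star_apply', RCLike.star_def]
  rw [hstar, hφ, jacobiSum_ringHomComp] at hmul
  exact_mod_cast (norm_eq_mul_conj _).trans hmul

theorem isPrimitiveRoot_omega : IsPrimitiveRoot omega 3 :=
  IsPrimitiveRoot.iff_orderOf.2 <| orderOf_eq_prime omega_cube fun h => by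
    simpa [omega, QuadraticAlgebra.im_one] using congrArg QuadraticAlgebra.im h

theorem three_dvd_jacobiSum_add_one (hdvd : 3 ∣ Fintype.card F - 1) (h3 : χ ^ 3 = 1) :
    (3 : EisensteinInt) ∣ jacobiSum χ χ + 1 := by
  obtain ⟨z, -, hz⟩ := exists_jacobiSum_eq_neg_one_add (by norm_num) h3 h3 hdvd
    isPrimitiveRoot_omega
  rw [hz]
  -- `(omega - 1) ^ 2 = -3 * omega`.
  exact ⟨-omega * z, by linear_combination z * one_add_omega_add_omega_sq⟩

theorem jacobiSum_eq (hπ : IsPrimary π) (hker : ∀ α, f α = 0 ↔ π ∣ α)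
    (hcard : (Fintype.card F : ℤ) = norm π) (h3 : χ ^ 3 = 1)
    (hχ : ∀ x, f (χ x) = x ^ ((Fintype.card F - 1) / 3)) : jacobiSum χ χ = π := by
  have hdvd := three_dvd_card_sub_one (F := F) hπ hcard
  have hnorm := norm_jacobiSum h3 (mulChar_ne_one hdvd hχ)
  obtain ⟨u, hu⟩ := dvd_jacobiSum hker hχ
  have h := three_dvd_jacobiSum_add_one hdvd h3
  rw [hu] at h hnorm ⊢
  have hpos : norm π ≠ 0 := by rw [Ne, norm_eq_zero_iff]; exact hπ.1.ne_zero
  have hu1 : norm u = 1 := by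
    rw [norm_mul, hcard] at hnorm
    exact mul_left_cancel₀ hpos (by rw [hnorm, mul_one])
  obtain ⟨c, hc⟩ := hπ.2
  obtain ⟨d, hd⟩ := h
  rw [eq_one_of_norm_eq_one hu1 ⟨u + c * u - d, by linear_combination u * hc - hd⟩, mul_one]

theorem pow_card_eq_one_iff_exists_cube (hdvd : 3 ∣ Fintype.card F - 1) {x : F} (hx : x ≠ 0) :
    x ^ ((Fintype.card F - 1) / 3) = 1 ↔ ∃ y, y ^ 3 = x := by
  obtain ⟨k, hk⟩ := hdvd
  have hone := Fintype.one_lt_card (α := F)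
  rw [hk, Nat.mul_div_cancel_left k (by norm_num)]
  constructor
  · intro h
    obtain ⟨g, hg⟩ := IsCyclic.exists_generator (α := Fˣ)
    have hord := orderOf_eq_card_of_forall_mem_zpowers hg
    rw [Nat.card_units, Nat.card_eq_fintype_card, hk] at hord
    -- With `x = g ^ n` and `g` of order `3 * k`, `x ^ k = 1` forces `3 ∣ n`.
    obtain ⟨n, hn⟩ := (Subgroup.mem_zpowers_iff).1 (hg (Units.mk0 x hx))
    have h' : g ^ (n * k) = 1 := by
      rw [zpow_mul, hn]
      ext
      simpa using h
    rw [← orderOf_dvd_iff_zpow_eq_one, hord] at h'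
    push_cast at h'
    obtain ⟨m, rfl⟩ := Int.dvd_of_mul_dvd_mul_right (by omega) h'
    refine ⟨(g ^ m : Fˣ), ?_⟩
    rw [← Units.val_pow_eq_pow_val, ← zpow_natCast, ← zpow_mul, mul_comm, Nat.cast_ofNat, hn,
      Units.val_mk0]
  · rintro ⟨y, rfl⟩
    have hy : y ≠ 0 := by rintro rfl; simp at hx
    rw [← pow_mul, ← hk, FiniteField.pow_card_sub_one_eq_one y hy]

theorem isCubicResidue_iff (hπ : IsPrimary π) (hf : Function.Surjective f)
    (hker : ∀ α, f α = 0 ↔ π ∣ α) (hcard : (Fintype.card F : ℤ) = norm π)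
    {α : EisensteinInt} (hα : ¬ π ∣ α) : IsCubicResidue π α ↔ cubicChar π α = 1 := by
  have hspec := cubicChar_spec hπ hker hcard α
  rw [← hker] at hα
  have h1 : cubicChar π α = 1 ↔ f (cubicChar π α) = 1 := by
    refine ⟨fun h => by rw [h, map_one], fun h => ?_⟩
    exact map_injOn hπ hker hspec.1 (by simp) (by rw [h, map_one])
  rw [h1, hspec.2, pow_card_eq_one_iff_exists_cube (three_dvd_card_sub_one hπ hcard) hα,
    hf.exists]
  simp only [IsCubicResidue, ← hker, map_sub, map_pow, sub_eq_zero]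

end ResidueField

end EisensteinInt

/-! ### Frobenius on the Gauss sum, and reciprocity -/

theorem gaussSum_frob_iterate {R R' : Type*} [CommRing R] [Fintype R] [CommRing R'] (p : ℕ)
    [Fact p.Prime] [CharP R' p] (n : ℕ) (χ : MulChar R R') (ψ : AddChar R R') :
    gaussSum χ ψ ^ p ^ n = gaussSum (χ ^ p ^ n) (ψ ^ p ^ n) := by
  induction n with
  | zero => simp
  | succ n ih => rw [pow_succ, pow_mul, ih, gaussSum_frob, pow_mul, pow_mul]

theorem natCast_card_ne_zero {F₁ F₂ : Type*} [Field F₁] [Finite F₁] [Field F₂] [Fintype F₂]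
    (h : ringChar F₁ ≠ ringChar F₂) : (Fintype.card F₂ : F₁) ≠ 0 := by
  obtain ⟨n, hp, hn⟩ := FiniteField.card F₂ (ringChar F₂)
  rw [Ne, ringChar.spec, hn]
  intro hdvd
  have h₁ : (ringChar F₁).Prime := CharP.char_is_prime F₁ _
  exact h ((Nat.prime_dvd_prime_iff_eq h₁ hp).1 (h₁.dvd_of_dvd_pow hdvd))

namespace EisensteinInt

theorem not_dvd_of_norm_ne {π₁ π₂ : EisensteinInt} (h₁ : Prime π₁) (h₂ : Prime π₂)
    (hN : norm π₁ ≠ norm π₂) : ¬ π₁ ∣ π₂ := by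
  rintro ⟨u, hu⟩
  rcases h₂.irreducible.isUnit_or_isUnit hu with hu' | hu'
  · exact h₁.not_isUnit hu'
  · rw [isUnit_iff_norm_eq_one] at hu'
    exact hN (by rw [hu, norm_mul, hu', mul_one])

/-- If both primes lay over the same `p`, their product would divide `p`, so `N π₁ * N π₂ ∣ p ^ 2`;
both norms would then equal `p`. -/
theorem ringChar_ne {π₁ π₂ : EisensteinInt} (h₁ : Prime π₁) (h₂ : Prime π₂)
    (hN : norm π₁ ≠ norm π₂) {F₁ F₂ : Type} [Field F₁] [Fintype F₁] [Field F₂] [Fintype F₂]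
    {f₁ : EisensteinInt →+* F₁} {f₂ : EisensteinInt →+* F₂}
    (hker₁ : ∀ α, f₁ α = 0 ↔ π₁ ∣ α) (hker₂ : ∀ α, f₂ α = 0 ↔ π₂ ∣ α)
    (hcard₁ : (Fintype.card F₁ : ℤ) = norm π₁) (hcard₂ : (Fintype.card F₂ : ℤ) = norm π₂) :
    ringChar F₁ ≠ ringChar F₂ := by
  intro h
  obtain ⟨m, hp, hm⟩ := FiniteField.card F₁ (ringChar F₁)
  obtain ⟨n, -, hn⟩ := FiniteField.card F₂ (ringChar F₂)
  rw [← h] at hn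
  set p := ringChar F₁
  have hd₁ : π₁ ∣ (p : EisensteinInt) := by
    rw [← hker₁, map_natCast]; exact ringChar.Nat.cast_ringChar
  have hd₂ : π₂ ∣ (p : EisensteinInt) := by
    rw [← hker₂, map_natCast, h]; exact ringChar.Nat.cast_ringChar
  obtain ⟨c, hc⟩ := hd₂
  rw [hc] at hd₁
  obtain ⟨d, rfl⟩ := (h₁.dvd_or_dvd hd₁).resolve_left (not_dvd_of_norm_ne h₁ h₂ hN)
  have hnorm := congrArg norm hc
  rw [norm_natCast, norm_mul, norm_mul, ← hcard₁, ← hcard₂, hm, hn] at hnorm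
  have hdvd : p ^ (n + m : ℕ) ∣ p ^ 2 := by
    rw [pow_add, ← Int.natCast_dvd_natCast]
    exact ⟨norm d, by push_cast; rw [hnorm]; push_cast; ring⟩
  have hle := (Nat.pow_dvd_pow_iff_le_right hp.one_lt).1 hdvd
  have hmpos := m.pos
  have hnpos := n.pos
  have hmn : (m : ℕ) = n := by omega
  exact hN (by rw [← hcard₁, ← hcard₂, hm, hn, hmn])

/-- The relation that comes from computing the `N π₂`-th power of the cubic Gauss sum modulo `π₁`,
taken in characteristic dividing `N π₂`, in two ways. -/
theorem cubicChar_mul_cubicChar_mul_cubicChar {π₁ π₂ : EisensteinInt}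
    (h₁ : IsPrimary π₁) (h₂ : IsPrimary π₂) (hN : norm π₁ ≠ norm π₂) :
    cubicChar π₁ (norm π₂) * cubicChar π₂ (norm π₁) * cubicChar π₂ π₁ = 1 := by
  obtain ⟨F₁, _, _, f₁, hf₁, hker₁, hcard₁⟩ := exists_residueField h₁.1
  obtain ⟨F₂, _, _, f₂, hf₂, hker₂, hcard₂⟩ := exists_residueField h₂.1
  have hchar := ringChar_ne h₁.1 h₂.1 hN hker₁ hker₂ hcard₁ hcard₂
  obtain ⟨χ, hχ, hχf⟩ := exists_mulChar h₁ hf₁ hker₁ hcard₁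
  have hdvd₁ := three_dvd_card_sub_one (F := F₁) h₁ hcard₁
  have hdvd₂ := three_dvd_card_sub_one (F := F₂) h₂ hcard₂
  have hχ1 : χ ≠ 1 := mulChar_ne_one hdvd₁ hχf
  have hχ3 : χ ^ 3 = 1 := mulChar_pow_three h₁ hker₁ hf₁ hcard₁ hχ
  have hJ : jacobiSum χ χ = π₁ := jacobiSum_eq h₁ hker₁ hcard₁ hχ3 hχf
  -- A primitive additive character of `F₁` takes its values in a cyclotomic extension `L` of `F₂`.
  let Ψ := AddChar.FiniteField.primitiveChar F₁ F₂ hchar.symm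
  let L := CyclotomicField Ψ.n F₂
  let i : F₂ →+* L := algebraMap F₂ L
  let φ : MulChar F₁ L := χ.ringHomComp (i.comp f₂)
  have hinj₂ := map_injOn h₂ hker₂
  have hmem : ∀ x, χ x ∈ ({0, 1, omega, omega ^ 2} : Set EisensteinInt) := fun x => by
    obtain ⟨α, rfl⟩ := hf₁ x
    rw [hχ]
    exact (cubicChar_spec h₁ hker₁ hcard₁ α).1
  have hφ3 : φ ^ 3 = 1 := by rw [MulChar.ringHomComp_pow, hχ3, MulChar.ringHomComp_one]
  have hφ1 : φ ≠ 1 := fun h => hχ1 <| MulChar.ext fun x => by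
    have hx : i (f₂ (χ x)) = 1 := by
      simpa [φ] using congrArg (fun η : MulChar F₁ L => η x) h
    rw [MulChar.one_apply_coe]
    exact hinj₂ (hmem x) (by simp) (by rw [map_one]; exact i.injective (by rw [hx, map_one]))
  have hord : orderOf φ = 3 := orderOf_eq_prime hφ3 hφ1
  have hneg : φ (-1) = 1 := by
    have h := congrArg (fun η : MulChar F₁ L => η ((-1 : F₁ˣ) : F₁)) hφ3
    simp only [MulChar.pow_apply_coe, MulChar.one_apply_coe, ← map_pow] at h
    simpa [show (-1 : F₁) ^ 3 = -1 by ring] using h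
  set g := gaussSum φ Ψ.char
  have hg3 : g ^ 3 = i (f₂ (norm π₁ * π₁)) := by
    have h := gaussSum_pow_eq_prod_jacobiSum (χ := φ) (ψ := Ψ.char) (by omega) Ψ.prim
    rw [hord] at h
    refine h.trans ?_
    rw [hneg, one_mul]
    simp only [show Finset.Ico 1 (3 - 1) = {1} from rfl, Finset.prod_singleton, pow_one]
    rw [jacobiSum_ringHomComp, hJ, ← hcard₁]
    simp
  obtain ⟨p, n, hp, hcardp, hcharp⟩ : ∃ p n : ℕ, p.Prime ∧ Fintype.card F₂ = p ^ n ∧ CharP F₂ p := by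
    obtain ⟨n, hp, hn⟩ := FiniteField.card F₂ (ringChar F₂)
    exact ⟨_, n, hp, hn, inferInstance⟩
  have : Fact p.Prime := ⟨hp⟩
  have : CharP L p := charP_of_injective_algebraMap i.injective p
  obtain ⟨k, hk⟩ := hdvd₂
  have hone := Fintype.one_lt_card (α := F₂)
  have hk' : Fintype.card F₂ = 3 * k + 1 := by omega
  have hπ : f₂ (norm π₁ * π₁) ≠ 0 := by
    rw [map_mul, map_intCast, ← hcard₁, Int.cast_natCast]
    exact mul_ne_zero (natCast_card_ne_zero hchar.symm)
      (mt (hker₂ _).1 (not_dvd_of_norm_ne h₂.1 h₁.1 hN.symm))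
  have hunit : (Fintype.card F₂ : F₁) ≠ 0 := natCast_card_ne_zero hchar
  have hg0 : g ≠ 0 := by
    intro h
    rw [h, zero_pow (by norm_num), eq_comm, map_eq_zero] at hg3
    exact hπ hg3
  -- Frobenius fixes `φ`, since `q = 3 * k + 1`, and turns `ψ(x)` into `ψ(q * x)`.
  have hfrob : φ (Fintype.card F₂) * g ^ Fintype.card F₂ = g := by
    have h : g ^ Fintype.card F₂ = gaussSum φ (Ψ.char.mulShift (Fintype.card F₂ : F₁)) := by
      rw [← AddChar.pow_mulShift, hcardp, gaussSum_frob_iterate, ← hcardp, hk', pow_succ φ,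
        pow_mul, hφ3, one_pow, one_mul]
    rw [h]
    exact gaussSum_mulShift φ Ψ.char (Units.mk0 _ hunit)
  rw [hk', pow_succ, pow_mul, hg3, ← mul_assoc, mul_eq_right₀ hg0, ← hk'] at hfrob
  have hspec := cubicChar_spec h₂ hker₂ hcard₂
  have hkdiv : (Fintype.card F₂ - 1) / 3 = k := by omega
  rw [hkdiv] at hspec
  refine hinj₂ (mul_mem_roots (mul_mem_roots (cubicChar_spec h₁ hker₁ hcard₁ _).1 (hspec _).1)
    (hspec _).1) (by simp) (i.injective ?_)
  rw [map_mul f₂, map_mul f₂, (hspec _).2, (hspec _).2, mul_assoc, ← mul_pow, ← map_mul f₂,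
    map_mul i, map_pow i, map_one, map_one, ← hfrob, ← hχ]
  congr 1
  simp only [← hcard₂, Int.cast_natCast, map_natCast]
  rfl

theorem cubicChar_comm {π₁ π₂ : EisensteinInt}
    (h₁ : IsPrimary π₁) (h₂ : IsPrimary π₂) (hN : norm π₁ ≠ norm π₂) :
    cubicChar π₁ π₂ = cubicChar π₂ π₁ := by
  have h := cubicChar_mul_cubicChar_mul_cubicChar h₁ h₂ hN
  have h' := cubicChar_mul_cubicChar_mul_cubicChar h₂ h₁ hN.symm
  -- Exchanging the primes only permutes the first two factors, which then cancel.
  rw [mul_comm (cubicChar π₂ _), ← h] at h'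
  exact mul_left_cancel₀ (left_ne_zero_of_mul_eq_one h) h'

theorem isCubicResidue_iff_cubicChar_eq_one {π α : EisensteinInt} (hπ : IsPrimary π)
    (hα : ¬ π ∣ α) : IsCubicResidue π α ↔ cubicChar π α = 1 := by
  obtain ⟨F, _, _, f, hf, hker, hcard⟩ := exists_residueField hπ.1
  exact isCubicResidue_iff hπ hf hker hcard hα

end EisensteinInt

theorem mainTheorem1 (π₁ π₂ : EisensteinInt)
    (h₁ : EisensteinInt.IsPrimary π₁) (h₂ : EisensteinInt.IsPrimary π₂)
    (hN₁ : EisensteinInt.norm π₁ ≠ 3) (hN₂ : EisensteinInt.norm π₂ ≠ 3)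
    (hN : EisensteinInt.norm π₁ ≠ EisensteinInt.norm π₂) :
    EisensteinInt.cubicChar π₁ π₂ = EisensteinInt.cubicChar π₂ π₁ ∧
      (EisensteinInt.IsCubicResidue π₂ π₁ ↔ EisensteinInt.IsCubicResidue π₁ π₂) := by
  have h := EisensteinInt.cubicChar_comm h₁ h₂ hN
  refine ⟨h, ?_⟩
  rw [EisensteinInt.isCubicResidue_iff_cubicChar_eq_one h₂
      (EisensteinInt.not_dvd_of_norm_ne h₂.1 h₁.1 hN.symm),
    EisensteinInt.isCubicResidue_iff_cubicChar_eq_one h₁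
      (EisensteinInt.not_dvd_of_norm_ne h₁.1 h₂.1 hN), h]
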